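/- Let $T\ge 1$ be an integer, $(\mathcal Z,\mathscr G)$ and $(\mathcal B,\mathscr H)$ measurable spaces, $0<L<\infty$, and $\ell:\mathcal B\times\mathcal Z\to[0,L]$ a measurable loss function. Let $P$ and $Q$ be probability measures on $\mathcal Z^T$ (with the product $\sigma$-algebra) and let $(Z_1,\dots,Z_T)$ denote the coordinates. Assume that $P$ admits Markov kernels $P_t:\mathcal Z^{t-1}\times\mathscr G\to[0,1]$, $t=1,\dots,T$, with $$P(Z_1\in G_1,\dots,Z_t\in G_t)=\int_{G_1\times\dots\times G_{t-1}}P_t(z_1,\dots,z_{t-1},G_t)\,P_{\{1,\dots,t-1\}}(dz_1,\dots,dz_{t-1})$$ for all $t$ and all $G_1,\dots,G_t\in\mathscr G$, where $P_{\{1,\dots,t-1\}}$ is the marginal distribution of $(Z_1,\dots,Z_{t-1})$ (for $t=1$ this says that $P_1$ is the distribution of $Z_1$), and that $Q$ admits Markov kernels $Q_t$ in the same sense; fix these kernels. Let $b_t,b_t^*:\mathcal Z^{t-1}\to\mathcal B$, $t=1,\dots,T$, be measurable maps such that for all $t$ and all $(z_1,\dots,z_{t-1})\in\mathcal Z^{t-1}$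 $$b_t(z_1,\dots,z_{t-1})\in\operatorname*{arg\,min}_{a\in\mathcal B}\int\ell(a,z)\,Q_t(z_1,\dots,z_{t-1},dz),\qquad b_t^*(z_1,\dots,z_{t-1})\in\operatorname*{arg\,min}_{a\in\mathcal B}\int\ell(a,z)\,P_t(z_1,\dots,z_{t-1},dz).$$ Define the average per-round regret $$\Delta:=\frac1T\sum_{t=1}^T\Big(\ell\big(b_t(Z_1,\dots,Z_{t-1}),Z_t\big)-\ell\big(b^*_t(Z_1,\dots,Z_{t-1}),Z_t\big)\Big)$$ and the expected variational distance $$V_T:=\mathbb E_P\Big[\frac1T\sum_{t=1}^T\sup_{F\in\mathscr G}\big|P_t(Z_1,\dots,Z_{t-1},F)-Q_t(Z_1,\dots,Z_{t-1},F)\big|\Big]$$ (understood as a lower integral if the integrand is not measurable), and let $D(P\|Q)\in[0,\infty]$ be the Kullback-Leibler divergence with natural logarithm, equal to $\infty$ if $P\not\ll Q$. Then for every $\delta\in(0,1]$, each of the following two inequalities holds with probability at least $1-\delta$ under $P$: $$\Delta<4L\,V_T\cdot\frac1\delta+\frac{2\sqrt2\,L}{\sqrt T}\sqrt{\log\frac2\delta},\qquad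 \Delta<2L\sqrt{\frac{D(P\|Q)}{T}}\cdot\frac1{\sqrt\delta}+\frac{2\sqrt2\,L}{\sqrt T}\sqrt{\log\frac2\delta},$$ where the right-hand side of the second inequality is $\infty$ if $D(P\|Q)=\infty$. -/

import Mathlib

open MeasureTheory ProbabilityTheory
open scoped ENNReal

namespace MismatchedPrediction

/-- The first `n` entries of a sequence of length `T`. -/
def initialSegment {Z : Type*} {T : ℕ} (n : ℕ) (hn : n ≤ T) (z : Fin T → Z) : Fin n → Z :=
  fun i => z (Fin.castLE hn i)

/-- The observations that precede the round `t`. Rounds are numbered `0, …, T - 1`, so that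
exactly `t` observations precede round `t`; there are none for the first round. -/
def past {Z : Type*} {T : ℕ} (t : Fin T) (z : Fin T → Z) : Fin (t : ℕ) → Z :=
  initialSegment (t : ℕ) t.isLt.le z

/-- `κ t` is a version of the conditional distribution under `P` of the observation of round `t`
given the preceding ones: for measurable `G₁, …, Gₙ, Gₙ₊₁`, where `n = t`,
`P(Z₁ ∈ G₁, …, Zₙ₊₁ ∈ Gₙ₊₁) = ∫_{G₁ × ⋯ × Gₙ} κ t (z₁, …, zₙ) Gₙ₊₁ dP_{1, …, n}(z₁, …, zₙ)`. -/
def IsConditionalKernels {Z : Type*} [MeasurableSpace Z] {T : ℕ} (P : Measure (Fin T → Z))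
    (κ : (t : Fin T) → Kernel (Fin (t : ℕ) → Z) Z) : Prop :=
  ∀ (t : Fin T) (G : Fin ((t : ℕ) + 1) → Set Z), (∀ i, MeasurableSet (G i)) →
    P.map (initialSegment ((t : ℕ) + 1) t.isLt) (Set.univ.pi G) =
      ∫⁻ h in Set.univ.pi (fun i : Fin (t : ℕ) => G i.castSucc), κ t h (G (Fin.last (t : ℕ)))
        ∂(P.map (initialSegment (t : ℕ) t.isLt.le))

/-- A policy `b` is optimal for the kernels `κ` if, after every possible history, its prediction
minimizes the conditional expectation of the loss over all predictions. -/
def IsOptimalPolicy {Z B : Type*} [MeasurableSpace Z] {T : ℕ}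
    (κ : (t : Fin T) → Kernel (Fin (t : ℕ) → Z) Z) (loss : B → Z → ℝ)
    (b : (t : Fin T) → (Fin (t : ℕ) → Z) → B) : Prop :=
  ∀ (t : Fin T) (h : Fin (t : ℕ) → Z) (a : B),
    ∫ z, loss (b t h) z ∂(κ t h) ≤ ∫ z, loss a z ∂(κ t h)

/-- The average per-round regret of the policy `b` relative to the policy `bstar` on the
realization `z` of the process. -/
noncomputable def avgRegret {Z B : Type*} {T : ℕ} (loss : B → Z → ℝ)
    (b bstar : (t : Fin T) → (Fin (t : ℕ) → Z) → B) (z : Fin T → Z) : ℝ :=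
  (1 / (T : ℝ)) * ∑ t : Fin T, (loss (b t (past t z)) (z t) - loss (bstar t (past t z)) (z t))

/-- The variational distance `sup_F |μ(F) - ν(F)|` over all measurable sets `F`, for probability
measures `μ` and `ν`. -/
noncomputable def tvDist {Z : Type*} [MeasurableSpace Z] (μ ν : Measure Z) : ℝ :=
  ⨆ F : {F : Set Z // MeasurableSet F}, |μ.real F.1 - ν.real F.1|

/-- The average over all rounds of the variational distance between the conditional distributions
of the next observation, as a function of the realization of the process. -/
noncomputable def avgInstVariation {Z : Type*} [MeasurableSpace Z] {T : ℕ}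
    (κP κQ : (t : Fin T) → Kernel (Fin (t : ℕ) → Z) Z) (z : Fin T → Z) : ℝ :=
  (1 / (T : ℝ)) * ∑ t : Fin T, tvDist (κP t (past t z)) (κQ t (past t z))

/-- The expectation under `P` of `avgInstVariation`. Its integrand is nonnegative and at most `1`,
so that the integral is finite. If the `σ`-algebra on `Z` is not countably generated, the integrand
need not be measurable; `∫⁻` is then the lower integral, the smallest value of the expectation
that could be meant. -/
noncomputable def expectedVariation {Z : Type*} [MeasurableSpace Z] {T : ℕ}
    (P : Measure (Fin T → Z)) (κP κQ : (t : Fin T) → Kernel (Fin (t : ℕ) → Z) Z) : ℝ :=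
  (∫⁻ z, ENNReal.ofReal (avgInstVariation κP κQ z) ∂P).toReal

end MismatchedPrediction

/-! Let g be the loss of `b` minus that of `bstar` in a given round. By optimality its conditional
mean is nonnegative under P and nonpositive under Q, so the P-mean lies between 0 and the difference
d of the two means. The regret minus the average M of the P-means is an average of bounded
martingale differences; Azuma-Hoeffding (`IsConditionalKernels.measureReal_deviation_le`) controls
it outside an event of probability δ/2. Markov's inequality bounds M outside another such event.

For the first inequality, g has range in an interval of length 2L, so d is at most 2L times the
variational distance and E M ≤ 2L V_T. For the second, Cauchy-Schwarz gives M² ≤ (1/T) ∑ d², and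
`integral_sum_sq_le_klDiv` bounds E ∑ d² by 2L² D(P‖Q). That bound tests the variational inequality
for D against the logarithm of an exponential supermartingale under Q with multipliers proportional
to d; this replaces the chain rule and Pinsker's inequality. -/

namespace MismatchedPrediction

/-! ### Divergence, variational distance, Markov and Hoeffding bounds on one space. -/

section General

variable {Ω : Type*} [MeasurableSpace Ω]

/-- Variational lower bound for the Kullback-Leibler divergence (one half of the
Donsker-Varadhan formula). -/
theorem integral_le_toReal_klDiv {P Q : Measure Ω} [IsProbabilityMeasure P]
    [IsProbabilityMeasure Q] (hD : InformationTheory.klDiv P Q ≠ ∞) {F : Ω → ℝ}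
    (hF : Measurable F) (hFint : Integrable F P)
    (hexp : ∫⁻ x, ENNReal.ofReal (Real.exp (F x)) ∂Q ≤ 1) :
    ∫ x, F x ∂P ≤ (InformationTheory.klDiv P Q).toReal := by
  obtain ⟨hac, hllr⟩ := InformationTheory.klDiv_ne_top_iff.mp hD
  rw [InformationTheory.toReal_klDiv_of_measure_eq hac (by simp)]
  -- P-almost everywhere exp(-llr) is the density of the P-continuous part of Q. Q may also have a
  -- singular part, hence only an inequality.
  have hlint : ∫⁻ x, ENNReal.ofReal (Real.exp (F x - llr P Q x)) ∂P ≤ 1 := by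
    calc ∫⁻ x, ENNReal.ofReal (Real.exp (F x - llr P Q x)) ∂P
        = ∫⁻ x, (Q.rnDeriv P * fun x => ENNReal.ofReal (Real.exp (F x))) x ∂P := by
          refine lintegral_congr_ae ?_
          filter_upwards [exp_neg_llr hac, Measure.rnDeriv_lt_top Q P] with x hx hx'
          rw [Pi.mul_apply, sub_eq_add_neg, Real.exp_add, hx,
            ENNReal.ofReal_mul (Real.exp_pos _).le, ENNReal.ofReal_toReal hx'.ne, mul_comm]
      _ = ∫⁻ x, ENNReal.ofReal (Real.exp (F x)) ∂(P.withDensity (Q.rnDeriv P)) :=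
          (lintegral_withDensity_eq_lintegral_mul P (Measure.measurable_rnDeriv Q P)
            (by fun_prop)).symm
      _ ≤ ∫⁻ x, ENNReal.ofReal (Real.exp (F x)) ∂Q :=
          lintegral_mono' (Measure.withDensity_rnDeriv_le Q P) le_rfl
      _ ≤ 1 := hexp
  have hmeas : AEStronglyMeasurable (fun x => Real.exp (F x - llr P Q x)) P :=
    (Real.measurable_exp.comp (hF.sub (measurable_llr P Q))).aestronglyMeasurable
  have hint : Integrable (fun x => Real.exp (F x - llr P Q x)) P := by
    refine ⟨hmeas, ?_⟩
    rw [hasFiniteIntegral_iff_ofReal (.of_forall fun x => (Real.exp_pos _).le)]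
    exact hlint.trans_lt ENNReal.one_lt_top
  have hle : ∫ x, Real.exp (F x - llr P Q x) ∂P ≤ 1 := by
    rw [integral_eq_lintegral_of_nonneg_ae (.of_forall fun x => (Real.exp_pos _).le) hmeas]
    exact ENNReal.toReal_le_of_le_ofReal zero_le_one (by simpa using hlint)
  -- The bound x + 1 ≤ exp x takes the place of Jensen's inequality.
  have hmono : ∫ x, (F x - llr P Q x + 1) ∂P ≤ ∫ x, Real.exp (F x - llr P Q x) ∂P :=
    integral_mono ((hFint.sub hllr).add (integrable_const 1)) hint
      fun x => Real.add_one_le_exp _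
  have hsplit : ∫ x, (F x - llr P Q x + 1) ∂P = ∫ x, F x ∂P - ∫ x, llr P Q x ∂P + ∫ _, 1 ∂P := by
    rw [← integral_sub hFint hllr]
    exact integral_add (hFint.sub hllr) (integrable_const 1)
  rw [hsplit] at hmono
  simp only [integral_const, probReal_univ, smul_eq_mul, mul_one] at hmono
  linarith

theorem tvDist_bddAbove (μ ν : Measure Ω) [IsProbabilityMeasure μ] [IsProbabilityMeasure ν] :
    BddAbove (Set.range fun F : {F : Set Ω // MeasurableSet F} => |μ.real F.1 - ν.real F.1|) := by
  refine ⟨1, ?_⟩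
  rintro _ ⟨F, rfl⟩
  have h1 := measureReal_nonneg (μ := μ) (s := F.1)
  have h2 := measureReal_nonneg (μ := ν) (s := F.1)
  have h3 := measureReal_le_one (μ := μ) (s := F.1)
  have h4 := measureReal_le_one (μ := ν) (s := F.1)
  exact abs_le.mpr ⟨by linarith, by linarith⟩

theorem sub_le_tvDist (μ ν : Measure Ω) [IsProbabilityMeasure μ] [IsProbabilityMeasure ν]
    {F : Set Ω} (hF : MeasurableSet F) : μ.real F - ν.real F ≤ tvDist μ ν :=
  (le_abs_self _).trans (le_ciSup (tvDist_bddAbove μ ν) ⟨F, hF⟩)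

theorem tvDist_le_one (μ ν : Measure Ω) [IsProbabilityMeasure μ] [IsProbabilityMeasure ν] :
    tvDist μ ν ≤ 1 := by
  refine Real.iSup_le (fun F => ?_) zero_le_one
  have h1 := measureReal_nonneg (μ := μ) (s := F.1)
  have h2 := measureReal_nonneg (μ := ν) (s := F.1)
  have h3 := measureReal_le_one (μ := μ) (s := F.1)
  have h4 := measureReal_le_one (μ := ν) (s := F.1)
  exact abs_le.mpr ⟨by linarith, by linarith⟩

/-- Layer-cake formula: both integrals are integrals over [0, M] of the measures of superlevel sets,
and each such set competes in the supremum. -/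
theorem integral_sub_integral_le_mul_tvDist (μ ν : Measure Ω) [IsProbabilityMeasure μ]
    [IsProbabilityMeasure ν] {f : Ω → ℝ} (hf : Measurable f) {M : ℝ} (hM : 0 ≤ M)
    (hfM : ∀ x, f x ∈ Set.Icc 0 M) :
    ∫ x, f x ∂μ - ∫ x, f x ∂ν ≤ M * tvDist μ ν := by
  have hint (ρ : Measure Ω) [IsProbabilityMeasure ρ] : Integrable f ρ :=
    Integrable.of_mem_Icc 0 M hf.aemeasurable (.of_forall hfM)
  have hcake (ρ : Measure Ω) [IsProbabilityMeasure ρ] :=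
    (hint ρ).integral_eq_integral_Ioc_meas_le (.of_forall fun x => (hfM x).1)
      (.of_forall fun x => (hfM x).2)
  have htail (ρ : Measure Ω) [IsProbabilityMeasure ρ] :
      IntegrableOn (fun t => ρ.real {a | t ≤ f a}) (Set.Ioc 0 M) := by
    have hanti : Antitone fun t : ℝ => ρ.real {a | t ≤ f a} :=
      fun s t hst => measureReal_mono fun a (ha : t ≤ f a) => hst.trans ha
    exact Integrable.of_mem_Icc 0 1 hanti.measurable.aemeasurable
      (.of_forall fun t => ⟨measureReal_nonneg, measureReal_le_one⟩)
  rw [hcake μ, hcake ν, ← integral_sub (htail μ) (htail ν)]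
  calc ∫ t in Set.Ioc 0 M, (μ.real {a | t ≤ f a} - ν.real {a | t ≤ f a})
      ≤ ∫ _ in Set.Ioc 0 M, tvDist μ ν :=
        integral_mono ((htail μ).sub (htail ν)) (integrable_const _)
          fun t => sub_le_tvDist μ ν (measurableSet_le measurable_const hf)
    _ = M * tvDist μ ν := by simp [hM]

/-- The strict event lets Markov's inequality include c = 0, which occurs when V_T or D(P‖Q)
vanishes: then Y = 0 almost everywhere. -/
theorem measureReal_lt_le_of_integral_le {P : Measure Ω} [IsProbabilityMeasure P] {Y : Ω → ℝ}
    (hY : Integrable Y P) (hY0 : ∀ x, 0 ≤ Y x) {c p : ℝ} (hc : 0 ≤ c) (hp : 0 ≤ p)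
    (h : ∫ x, Y x ∂P ≤ c * p) : P.real {x | c < Y x} ≤ p := by
  rcases hc.eq_or_lt with rfl | hc
  · have h0 : ∫ x, Y x ∂P = 0 := le_antisymm (by simpa using h) (integral_nonneg hY0)
    rw [integral_eq_zero_iff_of_nonneg hY0 hY] at h0
    have : P {x | 0 < Y x} = 0 := by
      rw [measure_eq_zero_iff_ae_notMem]
      filter_upwards [h0] with x hx
      simp [hx]
    simpa [Measure.real, this] using hp
  · have h1 := mul_meas_ge_le_integral_of_nonneg (.of_forall hY0) hY c
    have h2 : P.real {x | c < Y x} ≤ P.real {x | c ≤ Y x} :=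
      measureReal_mono fun x (hx : c < Y x) => hx.le
    exact h2.trans (le_of_mul_le_mul_left (h1.trans h) hc)

/-- Hoeffding's lemma, in a form suitable for iteration. -/
theorem lintegral_exp_hoeffding_le_one (ν : Measure Ω) [IsProbabilityMeasure ν] {g : Ω → ℝ}
    (hg : Measurable g) {L : ℝ} (hgL : ∀ y, |g y| ≤ L) (c : ℝ) :
    ∫⁻ y, ENNReal.ofReal (Real.exp (c * (g y - ∫ x, g x ∂ν) - c ^ 2 * L ^ 2 / 2)) ∂ν ≤ 1 := by
  have hsub := hasSubgaussianMGF_of_mem_Icc (μ := ν) (a := -L) (b := L) hg.aemeasurable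
    (.of_forall fun y => abs_le.mp (hgL y))
  have hmgf := hsub.mgf_le c
  have hint := hsub.integrable_exp_mul c
  -- The variance proxy is the squared half-length of [-L, L].
  have hconst : (((‖L - -L‖₊ / 2) ^ 2 : NNReal) : ℝ) = L ^ 2 := by
    rw [NNReal.coe_pow, NNReal.coe_div, coe_nnnorm, div_pow, Real.norm_eq_abs, sq_abs]
    push_cast
    ring
  rw [hconst, mgf] at hmgf
  simp_rw [Real.exp_sub _ (c ^ 2 * L ^ 2 / 2), div_eq_mul_inv,
    ENNReal.ofReal_mul (Real.exp_pos _).le]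
  rw [lintegral_mul_const' _ _ ENNReal.ofReal_ne_top,
    ← ofReal_integral_eq_lintegral_ofReal hint (.of_forall fun x => (Real.exp_pos _).le),
    ← ENNReal.ofReal_mul (integral_nonneg fun x => (Real.exp_pos _).le),
    ← ENNReal.ofReal_one]
  refine ENNReal.ofReal_le_ofReal ?_
  rw [← div_eq_mul_inv, div_le_one (Real.exp_pos _)]
  refine hmgf.trans (le_of_eq ?_)
  congr 1
  ring

end General

/-! ### Conditional kernels and exponential supermartingales. -/

section Disintegration

variable {Z : Type*} [MeasurableSpace Z] {T : ℕ}

theorem measurable_initialSegment (n : ℕ) (hn : n ≤ T) :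
    Measurable (initialSegment (Z := Z) n hn) :=
  measurable_pi_lambda _ fun _ => measurable_pi_apply _

theorem measurable_past (t : Fin T) : Measurable (past (Z := Z) t) :=
  measurable_initialSegment _ _

variable {P : Measure (Fin T → Z)} [IsProbabilityMeasure P]
  {κ : (t : Fin T) → Kernel (Fin (t : ℕ) → Z) Z} [∀ t, IsMarkovKernel (κ t)]

theorem IsConditionalKernels.map_past_eval (hκ : IsConditionalKernels P κ) (t : Fin T) :
    P.map (fun z => (past t z, z t)) = (P.map (past t)) ⊗ₘ (κ t) := by
  have hprob : IsProbabilityMeasure (P.map (past t)) :=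
    Measure.isProbabilityMeasure_map (measurable_past t).aemeasurable
  have hinit := measurable_initialSegment (Z := Z) ((t : ℕ) + 1) t.isLt
  have hprob' : IsProbabilityMeasure (P.map (initialSegment (Z := Z) ((t : ℕ) + 1) t.isLt)) :=
    Measure.isProbabilityMeasure_map hinit.aemeasurable
  let split : (Fin ((t : ℕ) + 1) → Z) → (Fin (t : ℕ) → Z) × Z :=
    fun x => (fun i => x i.castSucc, x (Fin.last _))
  let join : (Fin (t : ℕ) → Z) × Z → (Fin ((t : ℕ) + 1) → Z) :=
    fun p => Fin.snoc (α := fun _ => Z) p.1 p.2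
  have hsplit : Measurable split :=
    (measurable_pi_lambda _ fun i => measurable_pi_apply _).prodMk (measurable_pi_apply _)
  have hjoin : Measurable join := by
    refine measurable_pi_lambda _ fun i => ?_
    refine Fin.lastCases ?_ (fun j => ?_) i
    · simpa [join] using measurable_snd
    · have hj : Measurable fun p : (Fin (t : ℕ) → Z) × Z => p.1 j :=
        (measurable_pi_apply j).comp measurable_fst
      simpa only [join, Fin.snoc_castSucc] using hj
  -- The hypothesis speaks of boxes of sequences of length t + 1, a π-system there; `split` then
  -- carries the identity of measures to pairs.
  have key : P.map (initialSegment ((t : ℕ) + 1) t.isLt)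
      = ((P.map (past t)) ⊗ₘ (κ t)).map join := by
    refine ext_of_generate_finite _ generateFrom_pi.symm isPiSystem_pi ?_ ?_
    · rintro _ ⟨G, hG, rfl⟩
      have hG' : ∀ i, MeasurableSet (G i) := fun i => hG i (Set.mem_univ i)
      rw [hκ t G hG', Measure.map_apply hjoin (MeasurableSet.univ_pi hG')]
      have hpre : join ⁻¹' (Set.univ.pi G)
          = (Set.univ.pi fun i : Fin (t : ℕ) => G i.castSucc) ×ˢ G (Fin.last _) := by
        ext p
        simp only [Set.mem_preimage, Set.mem_univ_pi, Set.mem_prod, join]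
        rw [Fin.forall_fin_succ']
        simp
      rw [hpre, Measure.compProd_apply_prod (MeasurableSet.univ_pi fun i => hG' _) (hG' _)]
      rfl
    · have := Measure.isProbabilityMeasure_map (μ := (P.map (past t)) ⊗ₘ (κ t)) hjoin.aemeasurable
      simp
  have hcomp : split ∘ join = id := by
    funext p
    simp [split, join]
  have := congrArg (Measure.map split) key
  rw [Measure.map_map hsplit hinit, Measure.map_map hsplit hjoin, hcomp, Measure.map_id] at this
  exact this

/-- Supermartingale argument: integrating out the last round, given its past, removes its factor at
no cost; induct on the number of rounds. -/
theorem IsConditionalKernels.lintegral_prod_le_one (hκ : IsConditionalKernels P κ)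
    (f : (t : Fin T) → (Fin (t : ℕ) → Z) → Z → ℝ≥0∞)
    (hf : ∀ t, Measurable (Function.uncurry (f t)))
    (hf1 : ∀ t h, ∫⁻ y, f t h y ∂(κ t h) ≤ 1) :
    ∫⁻ z, ∏ t, f t (past t z) (z t) ∂P ≤ 1 := by
  have hmain : ∀ (n : ℕ) (hn : n ≤ T),
      ∫⁻ z, ∏ i : Fin n, f (Fin.castLE hn i) (past (Fin.castLE hn i) z) (z (Fin.castLE hn i)) ∂P
        ≤ 1 := by
    intro n
    induction n with
    | zero => simp
    | succ n ih =>
      intro hn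
      let t : Fin T := ⟨n, hn⟩
      have hn' : n ≤ T := (Nat.le_succ n).trans hn
      let V : (Fin n → Z) → ℝ≥0∞ := fun h =>
        ∏ i : Fin n, f (Fin.castLE hn' i) (past i h) (h i)
      have hV : Measurable V := Finset.measurable_prod _ fun i _ =>
        (hf (Fin.castLE hn' i)).comp ((measurable_past i).prodMk (measurable_pi_apply i))
      have hprob : IsProbabilityMeasure (P.map (past t)) :=
        Measure.isProbabilityMeasure_map (measurable_past t).aemeasurable
      have hVf : Measurable fun p : (Fin n → Z) × Z => V p.1 * f t p.1 p.2 :=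
        (hV.comp measurable_fst).mul (hf t)
      calc ∫⁻ z, ∏ i : Fin (n + 1),
            f (Fin.castLE hn i) (past (Fin.castLE hn i) z) (z (Fin.castLE hn i)) ∂P
          = ∫⁻ z, V (past t z) * f t (past t z) (z t) ∂P := by
            refine lintegral_congr fun z => ?_
            rw [Fin.prod_univ_castSucc]
            rfl
        _ = ∫⁻ p, V p.1 * f t p.1 p.2 ∂(P.map fun z => (past t z, z t)) :=
            (lintegral_map hVf ((measurable_past t).prodMk (measurable_pi_apply t))).symm
        _ = ∫⁻ h, ∫⁻ y, V h * f t h y ∂(κ t h) ∂(P.map (past t)) := by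
            rw [hκ.map_past_eval t, Measure.lintegral_compProd hVf]
        _ ≤ ∫⁻ h, V h ∂(P.map (past t)) := by
            refine lintegral_mono fun h => ?_
            have hfh : Measurable (f t h) := (hf t).comp measurable_prodMk_left
            rw [lintegral_const_mul _ hfh]
            exact mul_le_of_le_one_right' (hf1 t h)
        _ = ∫⁻ z, V (past t z) ∂P := lintegral_map hV (measurable_past t)
        _ ≤ 1 := ih hn'
  exact hmain T le_rfl

/-- Iterated Hoeffding lemma, with predictable multipliers `c`. -/
theorem IsConditionalKernels.lintegral_exp_sum_le_one (hκ : IsConditionalKernels P κ)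
    {g : (t : Fin T) → (Fin (t : ℕ) → Z) → Z → ℝ} (hg : ∀ t, Measurable (Function.uncurry (g t)))
    {L : ℝ} (hgL : ∀ t h y, |g t h y| ≤ L)
    {c : (t : Fin T) → (Fin (t : ℕ) → Z) → ℝ} (hc : ∀ t, Measurable (c t)) :
    ∫⁻ z, ENNReal.ofReal (Real.exp (∑ t, (c t (past t z) * (g t (past t z) (z t) -
      ∫ y, g t (past t z) y ∂(κ t (past t z))) - c t (past t z) ^ 2 * L ^ 2 / 2))) ∂P ≤ 1 := by
  have h := hκ.lintegral_prod_le_one (fun t h y => ENNReal.ofReal (Real.exp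
    (c t h * (g t h y - ∫ x, g t h x ∂(κ t h)) - c t h ^ 2 * L ^ 2 / 2))) (fun t => ?_)
    (fun t h => lintegral_exp_hoeffding_le_one _ ((hg t).comp measurable_prodMk_left)
      (hgL t h) _)
  · refine le_trans (le_of_eq (lintegral_congr fun z => ?_)) h
    rw [Real.exp_sum, ENNReal.ofReal_prod_of_nonneg fun _ _ => (Real.exp_pos _).le]
  · have hm : Measurable fun h => ∫ x, g t h x ∂(κ t h) :=
      (StronglyMeasurable.integral_kernel_prod_right' (κ := κ t)
        (hg t).stronglyMeasurable).measurable
    have hg' : Measurable fun p : (Fin (t : ℕ) → Z) × Z => g t p.1 p.2 := hg t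
    have hct : Measurable fun p : (Fin (t : ℕ) → Z) × Z => c t p.1 := (hc t).comp measurable_fst
    have hmt : Measurable fun p : (Fin (t : ℕ) → Z) × Z => ∫ x, g t p.1 x ∂(κ t p.1) :=
      hm.comp measurable_fst
    exact ((hct.mul (hg'.sub hmt)).sub
      (((hct.pow_const 2).mul_const _).div_const _)).exp.ennreal_ofReal

end Disintegration

/-! ### Martingale deviation and the divergence bound for conditional means. -/

section Deviation

variable {Z : Type*} [MeasurableSpace Z] {T : ℕ}
  {P : Measure (Fin T → Z)} [IsProbabilityMeasure P]
  {κ : (t : Fin T) → Kernel (Fin (t : ℕ) → Z) Z} [∀ t, IsMarkovKernel (κ t)]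
  {g : (t : Fin T) → (Fin (t : ℕ) → Z) → Z → ℝ} {L : ℝ}

theorem measurable_integral_kernel (hg : ∀ t, Measurable (Function.uncurry (g t))) (t : Fin T) :
    Measurable fun h => ∫ y, g t h y ∂(κ t h) :=
  (StronglyMeasurable.integral_kernel_prod_right' (κ := κ t) (hg t).stronglyMeasurable).measurable

theorem abs_integral_le_of_abs_le {Ω : Type*} [MeasurableSpace Ω] (ν : Measure Ω)
    [IsProbabilityMeasure ν] {f : Ω → ℝ} (hf : ∀ y, |f y| ≤ L) : |∫ y, f y ∂ν| ≤ L := by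
  have h := norm_integral_le_of_norm_le_const (μ := ν) (f := f) (C := L) (.of_forall hf)
  simpa using h

theorem integrable_of_abs_le {Ω : Type*} [MeasurableSpace Ω] (ν : Measure Ω)
    [IsProbabilityMeasure ν] {f : Ω → ℝ} (hfm : Measurable f) (hf : ∀ y, |f y| ≤ L) :
    Integrable f ν :=
  Integrable.of_bound hfm.aestronglyMeasurable L (.of_forall hf)

/-- Azuma-Hoeffding inequality for the deviation from the conditional means. -/
theorem IsConditionalKernels.measureReal_deviation_le (hκ : IsConditionalKernels P κ)
    (hg : ∀ t, Measurable (Function.uncurry (g t))) (hL : 0 < L) (hgL : ∀ t h y, |g t h y| ≤ L)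
    {ε : ℝ} (hε : 0 ≤ ε) :
    P.real {z | T * ε ≤ ∑ t, (g t (past t z) (z t) - ∫ y, g t (past t z) y ∂(κ t (past t z)))} ≤
      Real.exp (-(T * ε ^ 2 / (2 * L ^ 2))) := by
  -- The multiplier c = ε / L² maximizes c ε - c² L² / 2, with value ε² / (2 L²) per round.
  have hexp := hκ.lintegral_exp_sum_le_one hg hgL (c := fun _ _ => ε / L ^ 2)
    fun _ => measurable_const
  set S : (Fin T → Z) → ℝ := fun z => ∑ t, (ε / L ^ 2 * (g t (past t z) (z t) -
      ∫ y, g t (past t z) y ∂(κ t (past t z))) - (ε / L ^ 2) ^ 2 * L ^ 2 / 2) with hS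
  set a : ℝ := T * ε ^ 2 / (2 * L ^ 2) with ha
  have hSm : Measurable S := by
    refine Finset.measurable_sum _ fun t _ => ?_
    have h1 : Measurable fun z : Fin T → Z => g t (past t z) (z t) :=
      (hg t).comp ((measurable_past t).prodMk (measurable_pi_apply t))
    have h2 : Measurable fun z : Fin T → Z => ∫ y, g t (past t z) y ∂(κ t (past t z)) :=
      (measurable_integral_kernel hg t).comp (measurable_past t)
    exact ((h1.sub h2).const_mul _).sub_const _
  have hsub : {z | T * ε ≤ ∑ t, (g t (past t z) (z t) -
      ∫ y, g t (past t z) y ∂(κ t (past t z)))} ⊆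
      {z | ENNReal.ofReal (Real.exp a) ≤ ENNReal.ofReal (Real.exp (S z))} := by
    intro z hz
    refine ENNReal.ofReal_le_ofReal (Real.exp_le_exp.mpr ?_)
    simp only [Set.mem_ofPred_eq] at hz
    rw [hS]
    simp only
    rw [Finset.sum_sub_distrib, ← Finset.mul_sum]
    have h1 := mul_le_mul_of_nonneg_left hz (by positivity : 0 ≤ ε / L ^ 2)
    simp only [Finset.sum_const, Finset.card_univ, Fintype.card_fin, nsmul_eq_mul]
    have h2 : a = ε / L ^ 2 * (T * ε) - T * ((ε / L ^ 2) ^ 2 * L ^ 2 / 2) := by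
      rw [ha]
      field_simp
      ring
    linarith
  have hmarkov := mul_meas_ge_le_lintegral (μ := P) (hSm.exp.ennreal_ofReal)
    (ENNReal.ofReal (Real.exp a))
  have hP : ENNReal.ofReal (Real.exp a) * P {z | T * ε ≤ ∑ t, (g t (past t z) (z t) -
      ∫ y, g t (past t z) y ∂(κ t (past t z)))} ≤ 1 :=
    ((mul_le_mul_right (measure_mono hsub) _).trans hmarkov).trans hexp
  have hreal := ENNReal.toReal_mono ENNReal.one_ne_top hP
  rw [ENNReal.toReal_mul, ENNReal.toReal_ofReal (Real.exp_pos _).le, ENNReal.toReal_one] at hreal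
  rw [Real.exp_neg, ← one_div, le_div_iff₀ (Real.exp_pos _), mul_comm]
  exact hreal

theorem IsConditionalKernels.integral_past_eval (hκ : IsConditionalKernels P κ) (t : Fin T)
    {u : (Fin (t : ℕ) → Z) → Z → ℝ} (hu : Measurable (Function.uncurry u))
    (huL : ∀ h y, |u h y| ≤ L) :
    ∫ z, u (past t z) (z t) ∂P = ∫ z, ∫ y, u (past t z) y ∂(κ t (past t z)) ∂P := by
  have hprob : IsProbabilityMeasure (P.map (past t)) :=
    Measure.isProbabilityMeasure_map (measurable_past t).aemeasurable
  have hpair : Measurable fun z : Fin T → Z => (past t z, z t) :=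
    (measurable_past t).prodMk (measurable_pi_apply t)
  calc ∫ z, u (past t z) (z t) ∂P
      = ∫ p, Function.uncurry u p ∂(P.map fun z => (past t z, z t)) :=
        (integral_map hpair.aemeasurable hu.aestronglyMeasurable).symm
    _ = ∫ h, ∫ y, u h y ∂(κ t h) ∂(P.map (past t)) := by
        rw [hκ.map_past_eval t]
        exact Measure.integral_compProd (integrable_of_abs_le _ hu fun p => huL p.1 p.2)
    _ = ∫ z, ∫ y, u (past t z) y ∂(κ t (past t z)) ∂P :=
        integral_map (measurable_past t).aemeasurable
          (hu.stronglyMeasurable.integral_kernel_prod_right' (κ := κ t)).aestronglyMeasurable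

/-- The squared differences of the conditional means of a bounded function under two processes
are controlled by the Kullback-Leibler divergence of the processes. -/
theorem integral_sum_sq_le_klDiv {Q : Measure (Fin T → Z)} [IsProbabilityMeasure Q]
    {η : (t : Fin T) → Kernel (Fin (t : ℕ) → Z) Z} [∀ t, IsMarkovKernel (η t)]
    (hκ : IsConditionalKernels P κ) (hη : IsConditionalKernels Q η)
    (hg : ∀ t, Measurable (Function.uncurry (g t))) (hL : 0 < L) (hgL : ∀ t h y, |g t h y| ≤ L)
    (hD : InformationTheory.klDiv P Q ≠ ∞) :
    ∫ z, ∑ t, (∫ y, g t (past t z) y ∂(κ t (past t z)) -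
      ∫ y, g t (past t z) y ∂(η t (past t z))) ^ 2 ∂P ≤
        2 * L ^ 2 * (InformationTheory.klDiv P Q).toReal := by
  let d : (t : Fin T) → (Fin (t : ℕ) → Z) → ℝ := fun t h =>
    ∫ y, g t h y ∂(κ t h) - ∫ y, g t h y ∂(η t h)
  have hd : ∀ t, Measurable (d t) := fun t =>
    (measurable_integral_kernel hg t).sub (measurable_integral_kernel hg t)
  have hdL : ∀ t h, |d t h| ≤ 2 * L := fun t h => by
    have h1 := abs_le.mp (abs_integral_le_of_abs_le (κ t h) (hgL t h))
    have h2 := abs_le.mp (abs_integral_le_of_abs_le (η t h) (hgL t h))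
    exact abs_le.mpr ⟨by simp only [d]; linarith, by simp only [d]; linarith⟩
  -- This maximizes c d - c² L² / 2, the conditional P-mean of `u` below; the maximum is d² / (2
  -- L²).
  let c : (t : Fin T) → (Fin (t : ℕ) → Z) → ℝ := fun t h => d t h / L ^ 2
  have hc : ∀ t, Measurable (c t) := fun t => (hd t).div_const _
  have hcL : ∀ t h, |c t h| ≤ 2 / L := fun t h => by
    simp only [c]
    rw [abs_div, abs_of_pos (by positivity : 0 < L ^ 2), div_le_div_iff₀ (by positivity) hL]
    nlinarith [hdL t h]
  let u : (t : Fin T) → (Fin (t : ℕ) → Z) → Z → ℝ := fun t h y =>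
    c t h * (g t h y - ∫ x, g t h x ∂(η t h)) - c t h ^ 2 * L ^ 2 / 2
  have hu : ∀ t, Measurable (Function.uncurry (u t)) := fun t => by
    have hct : Measurable fun p : (Fin (t : ℕ) → Z) × Z => c t p.1 := (hc t).comp measurable_fst
    have hmt : Measurable fun p : (Fin (t : ℕ) → Z) × Z => ∫ x, g t p.1 x ∂(η t p.1) :=
      (measurable_integral_kernel hg t).comp measurable_fst
    exact (hct.mul ((hg t).sub hmt)).sub (((hct.pow_const 2).mul_const _).div_const _)
  -- Any constant would do; it serves only integrability.
  have huL : ∀ t h y, |u t h y| ≤ 6 := fun t h y => by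
    have h1 : |g t h y - ∫ x, g t h x ∂(η t h)| ≤ 2 * L := by
      have h1 := abs_le.mp (hgL t h y)
      have h2 := abs_le.mp (abs_integral_le_of_abs_le (η t h) (hgL t h))
      exact abs_le.mpr ⟨by linarith, by linarith⟩
    have h2 : |c t h * (g t h y - ∫ x, g t h x ∂(η t h))| ≤ 4 := by
      rw [abs_mul]
      calc _ ≤ 2 / L * (2 * L) := mul_le_mul (hcL t h) h1 (abs_nonneg _) (by positivity)
        _ = 4 := by field_simp; norm_num
    have h3 : c t h ^ 2 ≤ (2 / L) ^ 2 := sq_le_sq' (abs_le.mp (hcL t h)).1 (abs_le.mp (hcL t h)).2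
    have h4 : c t h ^ 2 * L ^ 2 ≤ 4 := by
      calc c t h ^ 2 * L ^ 2 ≤ (2 / L) ^ 2 * L ^ 2 := by gcongr
        _ = 4 := by field_simp; norm_num
    have h5 : 0 ≤ c t h ^ 2 * L ^ 2 := by positivity
    have h6 := abs_le.mp h2
    exact abs_le.mpr ⟨by simp only [u]; linarith, by simp only [u]; linarith⟩
  have hum : ∀ t, Measurable fun z : Fin T → Z => u t (past t z) (z t) := fun t =>
    (hu t).comp ((measurable_past t).prodMk (measurable_pi_apply t))
  have huint : ∀ t, Integrable (fun z : Fin T → Z => u t (past t z) (z t)) P := fun t =>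
    integrable_of_abs_le P (hum t) fun z => huL t _ _
  have hDV := integral_le_toReal_klDiv hD (F := fun z => ∑ t, u t (past t z) (z t))
    (Finset.measurable_sum _ fun t _ => hum t) (integrable_finsetSum _ fun t _ => huint t)
    (hη.lintegral_exp_sum_le_one hg hgL hc)
  have hinner : ∀ t h, ∫ y, u t h y ∂(κ t h) = d t h ^ 2 / (2 * L ^ 2) := fun t h => by
    have hgh : Integrable (g t h) (κ t h) :=
      integrable_of_abs_le _ ((hg t).comp measurable_prodMk_left) (hgL t h)
    have h1 : ∫ y, u t h y ∂(κ t h) = c t h * d t h - c t h ^ 2 * L ^ 2 / 2 := by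
      simp only [u]
      have hgi : Integrable (fun y => g t h y - ∫ x, g t h x ∂(η t h)) (κ t h) :=
        hgh.sub (integrable_const _)
      rw [integral_sub (hgi.const_mul _) (integrable_const _),
        integral_const_mul, integral_sub hgh (integrable_const _)]
      simp [d]
    rw [h1]
    simp only [c]
    field_simp
    ring
  have hsum : ∫ z, ∑ t, u t (past t z) (z t) ∂P
      = ∫ z, (∑ t, d t (past t z) ^ 2) / (2 * L ^ 2) ∂P := by
    have hdint : ∀ t, Integrable (fun z : Fin T → Z => d t (past t z) ^ 2 / (2 * L ^ 2)) P :=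
      fun t => integrable_of_abs_le (L := (2 * L) ^ 2 / (2 * L ^ 2)) P
        ((((hd t).comp (measurable_past t)).pow_const 2).div_const _) fun z => by
          rw [abs_of_nonneg (by positivity)]
          have := sq_le_sq' (abs_le.mp (hdL t (past t z))).1 (abs_le.mp (hdL t (past t z))).2
          gcongr
    simp_rw [Finset.sum_div]
    rw [integral_finsetSum _ fun t _ => huint t, integral_finsetSum _ fun t _ => hdint t]
    refine Finset.sum_congr rfl fun t _ => ?_
    rw [hκ.integral_past_eval t (hu t) (huL t)]
    simp_rw [hinner]
  rw [hsum, integral_div, div_le_iff₀ (by positivity)] at hDV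
  linarith

/-- Combination of two tail bounds. -/
theorem one_sub_le_measureReal_of_tails {Ω : Type*} [MeasurableSpace Ω] {P : Measure Ω}
    [IsProbabilityMeasure P] {X M : Ω → ℝ} {c ε δ : ℝ} {A : Set Ω}
    (h1 : P.real {z | ε ≤ X z - M z} ≤ δ / 2) (h2 : P.real {z | c < M z} ≤ δ / 2)
    (hA : ∀ z, X z < c + ε → z ∈ A) : 1 - δ ≤ P.real A := by
  have hcover : (Set.univ : Set Ω) ⊆ A ∪ ({z | ε ≤ X z - M z} ∪ {z | c < M z}) := by
    intro z _
    by_cases hz : ε ≤ X z - M z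
    · exact Or.inr (Or.inl hz)
    by_cases hz' : c < M z
    · exact Or.inr (Or.inr hz')
    · exact Or.inl (hA z (by linarith))
  have h3 := measureReal_mono (μ := P) hcover
  have h4 := measureReal_union_le (μ := P) A ({z | ε ≤ X z - M z} ∪ {z | c < M z})
  have h5 := measureReal_union_le (μ := P) {z | ε ≤ X z - M z} {z | c < M z}
  rw [probReal_univ] at h3
  linarith

end Deviation

end MismatchedPrediction

/-! ### The two regret bounds. -/

open MismatchedPrediction in
theorem theorem3 {Z B : Type*} [MeasurableSpace Z] [MeasurableSpace B]
    (T : ℕ) (hT : 0 < T)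
    (P Q : Measure (Fin T → Z)) [IsProbabilityMeasure P] [IsProbabilityMeasure Q]
    (κP κQ : (t : Fin T) → Kernel (Fin (t : ℕ) → Z) Z)
    [∀ t, IsMarkovKernel (κP t)] [∀ t, IsMarkovKernel (κQ t)]
    (hκP : MismatchedPrediction.IsConditionalKernels P κP)
    (hκQ : MismatchedPrediction.IsConditionalKernels Q κQ)
    (L : ℝ) (hL : 0 < L)
    (loss : B → Z → ℝ) (hloss : Measurable (Function.uncurry loss))
    (hbound : ∀ a z, loss a z ∈ Set.Icc 0 L)
    (b bstar : (t : Fin T) → (Fin (t : ℕ) → Z) → B)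
    (hb : ∀ t, Measurable (b t)) (hbstar : ∀ t, Measurable (bstar t))
    (hb_opt : MismatchedPrediction.IsOptimalPolicy κQ loss b)
    (hbstar_opt : MismatchedPrediction.IsOptimalPolicy κP loss bstar)
    (δ : ℝ) (hδ : δ ∈ Set.Ioc 0 1) :
    1 - δ ≤ P.real {z | MismatchedPrediction.avgRegret loss b bstar z <
        4 * L * MismatchedPrediction.expectedVariation P κP κQ * (1 / δ) +
          2 * Real.sqrt 2 * L / Real.sqrt T * Real.sqrt (Real.log (2 / δ))} ∧
    1 - δ ≤ P.real {z | ((MismatchedPrediction.avgRegret loss b bstar z : ℝ) : EReal) <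
        ((ENNReal.ofReal (2 * L) * (InformationTheory.klDiv P Q / (T : ℝ≥0∞)) ^ (1 / 2 : ℝ) *
            ENNReal.ofReal (1 / Real.sqrt δ) +
          ENNReal.ofReal (2 * Real.sqrt 2 * L / Real.sqrt T * Real.sqrt (Real.log (2 / δ)))
            : ℝ≥0∞) : EReal)} := by
  obtain ⟨hδ0, hδ1⟩ := hδ
  have hTr : (0 : ℝ) < T := by exact_mod_cast hT
  let g : (t : Fin T) → (Fin (t : ℕ) → Z) → Z → ℝ := fun t h y =>
    loss (b t h) y - loss (bstar t h) y
  have hg : ∀ t, Measurable (Function.uncurry (g t)) := fun t =>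
    (hloss.comp (((hb t).comp measurable_fst).prodMk measurable_snd)).sub
      (hloss.comp (((hbstar t).comp measurable_fst).prodMk measurable_snd))
  have hgL : ∀ t h y, |g t h y| ≤ L := fun t h y => by
    have h1 := hbound (b t h) y
    have h2 := hbound (bstar t h) y
    exact abs_le.mpr ⟨by linarith [h1.1, h2.2], by linarith [h1.2, h2.1]⟩
  have hlint (ν : Measure Z) [IsProbabilityMeasure ν] (a : B) : Integrable (loss a) ν :=
    Integrable.of_mem_Icc 0 L (hloss.comp measurable_prodMk_left).aemeasurable
      (.of_forall (hbound a))
  let mP : (t : Fin T) → (Fin (t : ℕ) → Z) → ℝ := fun t h => ∫ y, g t h y ∂(κP t h)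
  let mQ : (t : Fin T) → (Fin (t : ℕ) → Z) → ℝ := fun t h => ∫ y, g t h y ∂(κQ t h)
  have hmPm : ∀ t, Measurable fun z : Fin T → Z => mP t (past t z) := fun t =>
    (measurable_integral_kernel hg t).comp (measurable_past t)
  have hmQm : ∀ t, Measurable fun z : Fin T → Z => mQ t (past t z) := fun t =>
    (measurable_integral_kernel hg t).comp (measurable_past t)
  have hmP0 : ∀ t h, 0 ≤ mP t h := fun t h => by
    simp only [mP, g]
    rw [integral_sub (hlint _ _) (hlint _ _)]
    linarith [hbstar_opt t h (b t h)]
  have hmQ0 : ∀ t h, mQ t h ≤ 0 := fun t h => by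
    simp only [mQ, g]
    rw [integral_sub (hlint _ _) (hlint _ _)]
    linarith [hb_opt t h (bstar t h)]
  have hmPL : ∀ t h, |mP t h| ≤ L := fun t h => abs_integral_le_of_abs_le _ (hgL t h)
  have hmQL : ∀ t h, |mQ t h| ≤ L := fun t h => abs_integral_le_of_abs_le _ (hgL t h)
  have hmPtv : ∀ t h, mP t h ≤ 2 * L * tvDist (κP t h) (κQ t h) := fun t h => by
    -- Adding L moves the range of `g` into [0, 2L] and cancels in the difference of the means.
    have h1 := integral_sub_integral_le_mul_tvDist (κP t h) (κQ t h) (f := fun y => g t h y + L)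
      (((hg t).comp measurable_prodMk_left).add_const L) (M := 2 * L) (by positivity) fun y => by
        have := abs_le.mp (hgL t h y)
        exact ⟨by linarith, by linarith⟩
    have hgi (ν : Measure Z) [IsProbabilityMeasure ν] : Integrable (g t h) ν :=
      integrable_of_abs_le ν ((hg t).comp measurable_prodMk_left) (hgL t h)
    rw [integral_add (hgi _) (integrable_const _), integral_add (hgi _) (integrable_const _)] at h1
    simp only [integral_const, probReal_univ, smul_eq_mul, one_mul] at h1
    have h2 := hmQ0 t h
    simp only [mP, mQ] at h2 ⊢
    linarith
  let M : (Fin T → Z) → ℝ := fun z => (1 / (T : ℝ)) * ∑ t, mP t (past t z)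
  have hMm : Measurable M := (Finset.measurable_sum _ fun t _ => hmPm t).const_mul _
  have hM0 : ∀ z, 0 ≤ M z := fun z =>
    mul_nonneg (by positivity) (Finset.sum_nonneg fun t _ => hmP0 t _)
  have hML : ∀ z, M z ≤ L := fun z => by
    have h1 : ∑ t, mP t (past t z) ≤ ∑ _t : Fin T, L :=
      Finset.sum_le_sum fun t _ => (abs_le.mp (hmPL t (past t z))).2
    simp only [Finset.sum_const, Finset.card_univ, Fintype.card_fin, nsmul_eq_mul] at h1
    simp only [M]
    rw [one_div, inv_mul_le_iff₀ hTr]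
    exact h1
  have hMint : Integrable M P :=
    integrable_of_abs_le P hMm fun z => (abs_of_nonneg (hM0 z)).trans_le (hML z)
  set l : ℝ := Real.log (2 / δ) with hl
  have hl0 : 0 ≤ l := Real.log_nonneg (by rw [le_div_iff₀ hδ0]; linarith)
  set ε : ℝ := 2 * Real.sqrt 2 * L / Real.sqrt T * Real.sqrt l with hε
  have hε0 : 0 ≤ ε := by positivity
  -- An exponent of `l` would suffice for δ/2, so the constant 2√2 has a factor 2 to spare.
  have hε2 : T * ε ^ 2 / (2 * L ^ 2) = 4 * l := by
    rw [hε, mul_pow, div_pow, mul_pow, mul_pow, Real.sq_sqrt hl0, Real.sq_sqrt hTr.le,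
      Real.sq_sqrt (by norm_num)]
    field_simp
    ring
  have hdev : P.real {z | ε ≤ avgRegret loss b bstar z - M z} ≤ δ / 2 := by
    have h1 := hκP.measureReal_deviation_le hg hL hgL hε0
    have h2 : {z | ε ≤ avgRegret loss b bstar z - M z} =
        {z | T * ε ≤ ∑ t, (g t (past t z) (z t) -
          ∫ y, g t (past t z) y ∂(κP t (past t z)))} := by
      ext z
      simp only [Set.mem_ofPred_eq, avgRegret, M, mP]
      rw [← mul_sub, ← Finset.sum_sub_distrib, one_div, le_inv_mul_iff₀ hTr]
    rw [h2]
    refine h1.trans ?_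
    rw [hε2]
    calc Real.exp (-(4 * l)) ≤ Real.exp (-l) := Real.exp_le_exp.mpr (by linarith)
      _ = δ / 2 := by rw [Real.exp_neg, hl, Real.exp_log (by positivity), inv_div]
  constructor
  · refine one_sub_le_measureReal_of_tails (M := M) hdev ?_ fun z hz => hz
    have hV0 : 0 ≤ expectedVariation P κP κQ := ENNReal.toReal_nonneg
    -- With threshold 4L V_T / δ and probability δ/2, the required bound is E M ≤ 2L V_T.
    refine measureReal_lt_le_of_integral_le hMint hM0 (by positivity) (by positivity) ?_
    have hMtv : ∀ z, M z ≤ 2 * L * avgInstVariation κP κQ z := fun z => by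
      have h1 : ∑ t, mP t (past t z) ≤
          ∑ t, 2 * L * tvDist (κP t (past t z)) (κQ t (past t z)) :=
        Finset.sum_le_sum fun t _ => hmPtv t _
      rw [← Finset.mul_sum] at h1
      have h2 := mul_le_mul_of_nonneg_left h1 (by positivity : 0 ≤ 1 / (T : ℝ))
      simp only [M, avgInstVariation]
      linarith
    have hV1 : ∀ z, avgInstVariation κP κQ z ≤ 1 := fun z => by
      have h1 : ∑ t, tvDist (κP t (past t z)) (κQ t (past t z)) ≤ ∑ _t : Fin T, (1 : ℝ) :=
        Finset.sum_le_sum fun t _ => tvDist_le_one _ _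
      simp only [Finset.sum_const, Finset.card_univ, Fintype.card_fin, nsmul_eq_mul] at h1
      simp only [avgInstVariation]
      rw [one_div, inv_mul_le_iff₀ hTr]
      exact h1
    -- Finiteness matters, since `toReal` would send ∞ to 0.
    have hfin : ∫⁻ z, ENNReal.ofReal (avgInstVariation κP κQ z) ∂P ≠ ∞ := by
      refine ne_top_of_le_ne_top ENNReal.one_ne_top ?_
      calc ∫⁻ z, ENNReal.ofReal (avgInstVariation κP κQ z) ∂P ≤ ∫⁻ _, 1 ∂P :=
            lintegral_mono fun z => ENNReal.ofReal_le_one.mpr (hV1 z)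
        _ = 1 := by simp
    have hMV : ∫ z, M z ∂P ≤ 2 * L * expectedVariation P κP κQ := by
      rw [integral_eq_lintegral_of_nonneg_ae (.of_forall hM0) hMm.aestronglyMeasurable]
      have h1 : ∫⁻ z, ENNReal.ofReal (M z) ∂P ≤
          ENNReal.ofReal (2 * L) * ∫⁻ z, ENNReal.ofReal (avgInstVariation κP κQ z) ∂P := by
        -- A finite constant leaves the lower integral without measurability of the integrand.
        rw [← lintegral_const_mul' _ _ ENNReal.ofReal_ne_top]
        refine lintegral_mono fun z => ?_
        rw [← ENNReal.ofReal_mul (by positivity)]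
        exact ENNReal.ofReal_le_ofReal (hMtv z)
      have h2 := ENNReal.toReal_mono (ENNReal.mul_ne_top ENNReal.ofReal_ne_top hfin) h1
      rwa [ENNReal.toReal_mul, ENNReal.toReal_ofReal (by positivity)] at h2
    refine hMV.trans (le_of_eq ?_)
    field_simp
    ring
  · by_cases hD : InformationTheory.klDiv P Q = ∞
    · have htop : (ENNReal.ofReal (2 * L) *
          (InformationTheory.klDiv P Q / (T : ℝ≥0∞)) ^ (1 / 2 : ℝ) *
            ENNReal.ofReal (1 / Real.sqrt δ) + ENNReal.ofReal ε : ℝ≥0∞) = ∞ := by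
        have h1 : ENNReal.ofReal (2 * L) ≠ 0 := by
          rw [Ne, ENNReal.ofReal_eq_zero, not_le]; positivity
        have h2 : ENNReal.ofReal (1 / Real.sqrt δ) ≠ 0 := by
          rw [Ne, ENNReal.ofReal_eq_zero, not_le]; positivity
        rw [hD, ENNReal.top_div_of_ne_top (ENNReal.natCast_ne_top T),
          ENNReal.top_rpow_of_pos (by norm_num), ENNReal.mul_top h1, ENNReal.top_mul h2, top_add]
      rw [htop]
      simp only [EReal.coe_ennreal_top, EReal.coe_lt_top, Set.ofPred_true, probReal_univ]
      linarith
    · set D : ℝ := (InformationTheory.klDiv P Q).toReal with hDdef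
      have hD0 : 0 ≤ D := ENNReal.toReal_nonneg
      set r : ℝ := 2 * L * Real.sqrt (D / T) * (1 / Real.sqrt δ) with hr
      have hr0 : 0 ≤ r := by positivity
      have hrhs : ENNReal.ofReal (2 * L) *
          (InformationTheory.klDiv P Q / (T : ℝ≥0∞)) ^ (1 / 2 : ℝ) *
            ENNReal.ofReal (1 / Real.sqrt δ) + ENNReal.ofReal ε = ENNReal.ofReal (r + ε) := by
        rw [← ENNReal.ofReal_toReal hD, ← hDdef, ← ENNReal.ofReal_natCast T,
          ← ENNReal.ofReal_div_of_pos hTr, ENNReal.ofReal_rpow_of_nonneg (by positivity)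
          (by norm_num), ← Real.sqrt_eq_rpow, ← ENNReal.ofReal_mul (by positivity),
          ← ENNReal.ofReal_mul (by positivity), ← ENNReal.ofReal_add hr0 hε0]
      rw [hrhs]
      refine one_sub_le_measureReal_of_tails (M := M) (c := r) hdev ?_ fun z hz => ?_
      swap
      · simp only [Set.mem_ofPred_eq]
        rw [EReal.coe_ennreal_ofReal, EReal.coe_lt_coe_iff]
        exact hz.trans_le (le_max_left _ _)
      have hr2 : r ^ 2 = 4 * L ^ 2 * D / (T * δ) := by
        rw [hr, mul_pow, mul_pow, mul_pow, div_pow, Real.sq_sqrt (by positivity),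
          Real.sq_sqrt hδ0.le]
        field_simp
        ring
      -- Markov is applied to M², which yields 1/√δ rather than 1/δ.
      have hsub : {z | r < M z} ⊆ {z | r ^ 2 < M z ^ 2} :=
        fun z (hz : r < M z) => pow_lt_pow_left₀ hz hr0 two_ne_zero
      refine (measureReal_mono hsub).trans ?_
      have hM2 : ∀ z, M z ^ 2 ≤ L ^ 2 := fun z => pow_le_pow_left₀ (hM0 z) (hML z) 2
      have hM2int : Integrable (fun z => M z ^ 2) P :=
        integrable_of_abs_le P (hMm.pow_const 2) fun z =>
          (abs_of_nonneg (sq_nonneg _)).trans_le (hM2 z)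
      refine measureReal_lt_le_of_integral_le hM2int (fun z => sq_nonneg _) (sq_nonneg _)
        (by positivity) ?_
      have hkl := integral_sum_sq_le_klDiv hκP hκQ hg hL hgL hD
      have hdL : ∀ t h, (mP t h - mQ t h) ^ 2 ≤ (2 * L) ^ 2 := fun t h => by
        have h1 := abs_le.mp (hmPL t h)
        have h2 := abs_le.mp (hmQL t h)
        exact sq_le_sq' (by linarith) (by linarith)
      have hdint : Integrable (fun z => ∑ t, (mP t (past t z) - mQ t (past t z)) ^ 2) P :=
        integrable_finsetSum _ fun t _ => integrable_of_abs_le (L := (2 * L) ^ 2) P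
          (((hmPm t).sub (hmQm t)).pow_const 2) fun z =>
            (abs_of_nonneg (sq_nonneg _)).trans_le (hdL t _)
      -- Cauchy-Schwarz, then 0 ≤ `mP` ≤ `mP` - `mQ` by the signs of the means.
      have hMsq : ∀ z, M z ^ 2 ≤ 1 / (T : ℝ) * ∑ t, (mP t (past t z) - mQ t (past t z)) ^ 2 := by
        intro z
        have h1 := sq_sum_le_card_mul_sum_sq (s := Finset.univ) (f := fun t => mP t (past t z))
        have h2 : ∑ t, mP t (past t z) ^ 2 ≤ ∑ t, (mP t (past t z) - mQ t (past t z)) ^ 2 :=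
          Finset.sum_le_sum fun t _ => pow_le_pow_left₀ (hmP0 t _)
            (by linarith [hmQ0 t (past t z)]) 2
        simp only [Finset.card_univ, Fintype.card_fin] at h1
        calc M z ^ 2 = (1 / (T : ℝ)) ^ 2 * (∑ t, mP t (past t z)) ^ 2 := mul_pow _ _ _
          _ ≤ (1 / (T : ℝ)) ^ 2 * (T * ∑ t, (mP t (past t z) - mQ t (past t z)) ^ 2) := by
            gcongr
            exact h1.trans (by gcongr)
          _ = 1 / (T : ℝ) * ∑ t, (mP t (past t z) - mQ t (past t z)) ^ 2 := by
            field_simp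
      calc ∫ z, M z ^ 2 ∂P
          ≤ ∫ z, 1 / (T : ℝ) * ∑ t, (mP t (past t z) - mQ t (past t z)) ^ 2 ∂P :=
            integral_mono hM2int (hdint.const_mul _) hMsq
        _ = 1 / (T : ℝ) * ∫ z, ∑ t, (mP t (past t z) - mQ t (past t z)) ^ 2 ∂P :=
            integral_const_mul _ _
        _ ≤ 1 / (T : ℝ) * (2 * L ^ 2 * D) := mul_le_mul_of_nonneg_left hkl (by positivity)
        _ = r ^ 2 * (δ / 2) := by
            rw [hr2]
            field_simp
            ring
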